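/- Fix an integer $d\ge 2$, put $k=\lfloor d/2\rfloor$, and let $0\le i\le k$. A $2$-cylindric partition of profile $[d-i,i]$ is a pair of sequences of non-negative integers $(\pi_{1,j})_{j>i}$ and $(\pi_{2,j})_{j>0}$, with only finitely many non-zero entries, such that $\pi_{s,j}\ge\pi_{s,j+1}$ for $s\in\{1,2\}$ and every $j$ in the range of row $s$, $\pi_{1,j}\ge\pi_{2,j}$ for all $j>i$, and $\pi_{2,j}\ge\pi_{1,j+d}$ for all $j>0$. Let $|\pi|$ be the sum of the entries of $\pi$ and let $F_{d,i}(q)=\sum_\pi q^{|\pi|}$ be the generating function, as a formal power series, of all $2$-cylindric partitions of profile $[d-i,i]$. Write $(z;q)_n=\prod_{m=0}^{n-1}(1-zq^m)$, $(z;q)_\infty=\prod_{m\ge0}(1-zq^m)$, and let $\mathcal P_k$ be the set of partitions $\lambda=(\lambda_1\ge\lambda_2\ge\cdots\ge\lambda_k\ge0)$ with at most $k$ non-zero parts. Then, as formal power series in $q$ (all the infinite sums being coefficientwise convergent), $$F_{d,i}(q)=\frac1{(q;q)_\infty}\sum_{\lambda\in\mathcal P_k}\frac{q^{\lambda_1^2+\cdots+\lambda_k^2+\lambda_{i+1}+\lambda_{i+2}+\cdots+\lambda_k}}{(q;q)_{\lambda_1-\lambda_2}(q;q)_{\lambda_2-\lambda_3}\cdots(q;q)_{\lambda_{k-1}-\lambda_k}\,(q;q)_{\lambda_k}}\qquad\text{if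 $d$ is odd,}$$ $$F_{d,i}(q)=\frac1{(q;q)_\infty}\sum_{\lambda\in\mathcal P_k}\frac{q^{\lambda_1^2+\cdots+\lambda_k^2+\lambda_{i+1}+\lambda_{i+2}+\cdots+\lambda_k}}{(q;q)_{\lambda_1-\lambda_2}(q;q)_{\lambda_2-\lambda_3}\cdots(q;q)_{\lambda_{k-1}-\lambda_k}\,(q^2;q^2)_{\lambda_k}}\qquad\text{if $d$ is even.}$$ Moreover, these expressions are non-negative: the power series $1/(q;q)_\infty$ and every summand of the two sums have non-negative coefficients. -/

import Mathlib

open scoped PowerSeries PowerSeries.WithPiTopology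

noncomputable section

/-! Formal power series in `q` are elements of `ℤ⟦X⟧`, the letter `q` being `PowerSeries.X`; infinite
sums and products are taken coefficientwise (product topology, `ℤ` discrete). -/

/-- The q-shifted factorial `(z; q)_n = ∏_{i=0}^{n-1} (1 - z q^i)`. -/
def qPoch {R : Type*} [CommRing R] (z q : R) (n : ℕ) : R :=
  ∏ i ∈ Finset.range n, (1 - z * q ^ i)

/-- The infinite q-shifted factorial `(z; q)_∞ = ∏_{i ≥ 0} (1 - z q^i)`. -/
def qPochInf {R : Type*} [CommRing R] [TopologicalSpace R] (z q : R) : R :=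
  ∏' i : ℕ, (1 - z * q ^ i)

/-- `1 / φ` for a power series `φ` over `ℤ` with constant coefficient `1`. -/
def recip (φ : ℤ⟦X⟧) : ℤ⟦X⟧ := PowerSeries.invOfUnit φ 1

theorem mul_recip {φ : ℤ⟦X⟧} (h : PowerSeries.constantCoeff φ = 1) : φ * recip φ = 1 :=
  PowerSeries.mul_invOfUnit φ 1 (by simpa using h)

theorem constantCoeff_qPoch (f : ℕ) (hf : f ≠ 0) (n : ℕ) :
    PowerSeries.constantCoeff
      (qPoch ((PowerSeries.X : ℤ⟦X⟧) ^ f) (PowerSeries.X ^ f) n) = 1 := by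
  simp [qPoch, map_prod, hf]

theorem multipliable_qPochInf :
    Multipliable fun i : ℕ => (1 - PowerSeries.X * PowerSeries.X ^ i : ℤ⟦X⟧) := by
  have h := PowerSeries.WithPiTopology.multipliable_one_sub_X_pow (R := ℤ)
  simpa only [pow_succ'] using h

theorem constantCoeff_qPochInf :
    PowerSeries.constantCoeff (qPochInf (PowerSeries.X : ℤ⟦X⟧) PowerSeries.X) = 1 := by
  have h := multipliable_qPochInf.map_tprod (PowerSeries.constantCoeff (R := ℤ))
    (PowerSeries.WithPiTopology.continuous_constantCoeff ℤ)
  rw [qPochInf, h]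
  simp

/-- Cylindric partitions of type `(∞^r)/μ/d` with finitely many non-zero entries.
Row `s + 1` of the array is indexed by `s : Fin r`, and `μ s` is its shift, so that its entries
are `π (s, j)` for `j > μ s`; positions `(s, j)` with `j ≤ μ s` lie outside the array and are
filled with `0` by convention. -/
structure IsCylindricPartition {r : ℕ} (μ : Fin r → ℕ) (d : ℕ) (π : Fin r × ℕ →₀ ℕ) : Prop where
  outside : ∀ (s : Fin r) (j : ℕ), j ≤ μ s → π (s, j) = 0
  /-- entries are weakly decreasing across the rows -/
  row : ∀ (s : Fin r) (j : ℕ), μ s < j → π (s, j + 1) ≤ π (s, j)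
  /-- entries are weakly decreasing down the columns -/
  col : ∀ s t : Fin r, (t : ℕ) = (s : ℕ) + 1 →
    ∀ j : ℕ, max (μ s) (μ t) < j → π (t, j) ≤ π (s, j)
  /-- the cylindrical condition, relating the last row to the first one -/
  cyl : ∀ s t : Fin r, (s : ℕ) + 1 = r → (t : ℕ) = 0 →
    ∀ j : ℕ, μ s < j → μ t < j + d → π (t, j + d) ≤ π (s, j)

/-- The level `d = m_0 + ⋯ + m_{r-1}` of the weight `Λ = [m_0, …, m_{r-1}]`. -/
def weightLevel {r : ℕ} (m : Fin r → ℕ) : ℕ := ∑ i, m i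

/-- The partition attached to the weight `Λ = [m_0, …, m_{r-1}]`: its `j`-th part is
`m_j + ⋯ + m_{r-1}` for `1 ≤ j ≤ r - 1`, and its `r`-th part is `0`. Part `s + 1` is indexed
by `s : Fin r`. -/
def weightPartition {r : ℕ} (m : Fin r → ℕ) (s : Fin r) : ℕ := ∑ i ∈ Finset.Ioi s, m i

/-- The set of cylindric partitions labelled by the weight (profile) `[m_0, …, m_{r-1}]`. -/
def cylindricPartitions {r : ℕ} (m : Fin r → ℕ) : Set (Fin r × ℕ →₀ ℕ) :=
  {π | IsCylindricPartition (weightPartition m) (weightLevel m) π}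

/-- The norm of a cylindric partition: the sum of its entries. -/
def cpNorm {r : ℕ} (π : Fin r × ℕ →₀ ℕ) : ℕ := π.sum fun _ n => n

/-- The generating function of the cylindric partitions of profile `[m_0, …, m_{r-1}]`. -/
def cylindricGF {r : ℕ} (m : Fin r → ℕ) : ℤ⟦X⟧ :=
  ∑' π : cylindricPartitions m, PowerSeries.X ^ cpNorm π.1

/-- Partitions `l = (l_1, l_2, …)` with at most `k` non-zero parts; `l_j` is `l (j - 1)`. -/
def partitionsAtMost (k : ℕ) : Set (ℕ → ℕ) :=
  {l | Antitone l ∧ ∀ j, k ≤ j → l j = 0}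

/-- The exponent `l_1² + ⋯ + l_k² + l_{i+1} + ⋯ + l_k`. -/
def fermionicExponent (k i : ℕ) (l : ℕ → ℕ) : ℕ :=
  ∑ j ∈ Finset.range k, l j ^ 2 + ∑ j ∈ Finset.Ico i k, l j

/-- The product `(q;q)_{l_1-l_2} ⋯ (q;q)_{l_{k-1}-l_k} (q^f;q^f)_{l_k}`, for `k ≥ 1`. -/
def fermionicDenominator (k f : ℕ) (l : ℕ → ℕ) : ℤ⟦X⟧ :=
  (∏ j ∈ Finset.range (k - 1), qPoch PowerSeries.X PowerSeries.X (l j - l (j + 1))) *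
    qPoch (PowerSeries.X ^ f) (PowerSeries.X ^ f) (l (k - 1))

theorem constantCoeff_fermionicDenominator (k f : ℕ) (hf : f ≠ 0) (l : ℕ → ℕ) :
    PowerSeries.constantCoeff (fermionicDenominator k f l) = 1 := by
  have h1 : ∀ n, PowerSeries.constantCoeff
      (qPoch (PowerSeries.X : ℤ⟦X⟧) PowerSeries.X n) = 1 := fun n => by
    simpa using constantCoeff_qPoch 1 one_ne_zero n
  rw [fermionicDenominator, map_mul, map_prod, constantCoeff_qPoch f hf]
  simp [h1]

/-- The summand labelled by the partition `l`; `f = 1` and `f = 2` give the two versions. -/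
def fermionicTerm (k i f : ℕ) (l : ℕ → ℕ) : ℤ⟦X⟧ :=
  PowerSeries.X ^ fermionicExponent k i l * recip (fermionicDenominator k f l)

/-- All coefficients of the power series are non-negative. -/
def NonnegCoeffs (φ : ℤ⟦X⟧) : Prop := ∀ n : ℕ, 0 ≤ PowerSeries.coeff n φ

end

/-!
The proof compares both sides before the limit of unbounded entries. Let `A_i(n)` be the generating
function of the cylindric partitions of profile `[d - i, i]` with all entries at most `n`. The
largest entry is the first one of some row. Removing the first entry of the first row, if it equals
`n`, changes the profile index `i` to `i + 1`; removing that of the second row changes it to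
`i - 1`. Inclusion–exclusion gives, for `n ≥ 1`,

  `A_i(n) = A_i(n-1) + q^n (A_{i-1}(n) + A_{i+1}(n)) - q^{2n} A_i(n)`,  `A_i(0) = 1`,

where the boundary cases are covered by the conventions `A_{-1}(n) = q^n A_0(n)` and
`A_{d+1}(n) = q^n A_d(n)` (`isBoundedGF_arrayGF`). The difference of two solutions is divisible by
every power of `q`, so the recursion has only one solution (`IsBoundedGF.unique`).

A solution at level `d`, extended by these conventions to the indices `-1, …, d + 1`, yields one at
level `d + 2`:

  `A'_i(n) = ∑_{m ≤ n} q^{m²} A_{i-1}(m) / (q;q)_{n-m}`,  `0 ≤ i ≤ d + 2`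

(`IsBoundedGF.burge`; this is a form of the Burge transform). The iteration starts with
`1 / (q;q)_n` at level `1` and with `1 / (q²;q²)_n` at level `0`. Unfolding it `k` times, for
`i ≤ k`, the conventions enter only at the lower end, where they produce the linear terms
`λ_{i+1} + ⋯ + λ_k`, and the result is the sum over partitions with an extra factor
`1 / (q;q)_{n-λ_1}` (`sum_topParts_fermionicTerm`). As `n` tends to infinity this factor becomes
`1 / (q;q)_∞` and `A_i(n)` becomes the generating function of all cylindric partitions
(`cylindricGF_eq`).
-/

noncomputable section

/-! ### Reciprocals of q-shifted factorials -/

theorem recip_unique {φ ψ : ℤ⟦X⟧} (h : PowerSeries.constantCoeff φ = 1) (hψ : φ * ψ = 1) :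
    ψ = recip φ := by
  calc ψ = (φ * recip φ) * ψ := by rw [mul_recip h, one_mul]
    _ = recip φ * (φ * ψ) := by ring
    _ = recip φ := by rw [hψ, mul_one]

theorem recip_one : recip 1 = 1 :=
  (recip_unique (by simp) (by simp)).symm

theorem recip_mul {φ ψ : ℤ⟦X⟧} (hφ : PowerSeries.constantCoeff φ = 1)
    (hψ : PowerSeries.constantCoeff ψ = 1) : recip (φ * ψ) = recip φ * recip ψ := by
  refine (recip_unique (by simp [hφ, hψ]) ?_).symm
  calc φ * ψ * (recip φ * recip ψ) = (φ * recip φ) * (ψ * recip ψ) := by ring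
    _ = 1 := by rw [mul_recip hφ, mul_recip hψ, one_mul]

theorem qPoch_succ {R : Type*} [CommRing R] (z q : R) (n : ℕ) :
    qPoch z q (n + 1) = qPoch z q n * (1 - z * q ^ n) :=
  Finset.prod_range_succ _ _

/-- The reciprocal `1 / (q^f; q^f)_n`. -/
def recipPoch (f n : ℕ) : ℤ⟦X⟧ :=
  recip (qPoch (PowerSeries.X ^ f) (PowerSeries.X ^ f) n)

theorem recipPoch_one (n : ℕ) :
    recipPoch 1 n = recip (qPoch PowerSeries.X PowerSeries.X n) := by
  simp [recipPoch]

theorem recipPoch_zero (f : ℕ) : recipPoch f 0 = 1 := by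
  simp [recipPoch, qPoch, recip_one]

theorem recipPoch_succ {f : ℕ} (hf : f ≠ 0) (n : ℕ) :
    (1 - PowerSeries.X ^ (f * (n + 1))) * recipPoch f (n + 1) = recipPoch f n := by
  refine recip_unique (constantCoeff_qPoch f hf n) ?_
  have e : qPoch ((PowerSeries.X : ℤ⟦X⟧) ^ f) (PowerSeries.X ^ f) (n + 1) =
      qPoch (PowerSeries.X ^ f) (PowerSeries.X ^ f) n * (1 - PowerSeries.X ^ (f * (n + 1))) := by
    rw [qPoch_succ, ← pow_succ', ← pow_mul]
  rw [← mul_assoc, ← e, recipPoch, mul_recip (constantCoeff_qPoch f hf (n + 1))]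

/-! ### The recursion in the bound on the entries -/

/-- Extension of a family `T 0, …, T d` of sequences by one entry on either side, the new
entries being `q ^ n` times their neighbours; the index is shifted by one, so that `T j` is the
entry `j + 1` of the extended family. -/
def extendFamily (d : ℕ) (T : ℕ → ℕ → ℤ⟦X⟧) : ℕ → ℕ → ℤ⟦X⟧
  | 0, n => PowerSeries.X ^ n * T 0 n
  | j + 1, n => if j ≤ d then T j n else PowerSeries.X ^ n * T d n

/-- The recursion that characterises the generating functions `T j n` of the cylindric partitions
of profile `[d - j, j]` with entries at most `n`. The boundary cases `j = 0` and `j = d` are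
subsumed by the conventions of `extendFamily`. -/
structure IsBoundedGF (d : ℕ) (T : ℕ → ℕ → ℤ⟦X⟧) : Prop where
  init : ∀ j ≤ d, T j 0 = 1
  rec_succ : ∀ j ≤ d, ∀ n, T j (n + 1) = T j n +
    PowerSeries.X ^ (n + 1) * (extendFamily d T j (n + 1) + extendFamily d T (j + 2) (n + 1)) -
    PowerSeries.X ^ (2 * (n + 1)) * T j (n + 1)

theorem eq_zero_of_forall_X_pow_dvd {φ : ℤ⟦X⟧} (h : ∀ m : ℕ, PowerSeries.X ^ m ∣ φ) :
    φ = 0 := by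
  ext m
  simpa using PowerSeries.X_pow_dvd_iff.1 (h (m + 1)) m (Nat.lt_succ_self m)

/-- Given the values at `n`, the recursion determines those at `n + 1`, because the difference of
two solutions is divisible by every power of `q`. -/
theorem IsBoundedGF.unique {d : ℕ} {T T' : ℕ → ℕ → ℤ⟦X⟧} (h : IsBoundedGF d T)
    (h' : IsBoundedGF d T') (n : ℕ) : ∀ j ≤ d, T j n = T' j n := by
  induction n with
  | zero => intro j hj; rw [h.init j hj, h'.init j hj]
  | succ n ih =>
    have key : ∀ m : ℕ, ∀ j ≤ d, PowerSeries.X ^ m ∣ T j (n + 1) - T' j (n + 1) := by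
      intro m
      induction m with
      | zero => simp
      | succ m ihm =>
        have hext : ∀ j, PowerSeries.X ^ m ∣
            extendFamily d T j (n + 1) - extendFamily d T' j (n + 1) := by
          intro j
          cases j with
          | zero =>
            rw [extendFamily, extendFamily, ← mul_sub]
            exact (ihm 0 (Nat.zero_le d)).mul_left _
          | succ j =>
            simp only [extendFamily]
            split_ifs with hj
            · exact ihm j hj
            · rw [← mul_sub]
              exact (ihm d le_rfl).mul_left _
        intro j hj
        obtain ⟨a, ha⟩ := hext j
        obtain ⟨b, hb⟩ := hext (j + 2)
        obtain ⟨c, hc⟩ := ihm j hj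
        have e := ih j hj
        have e1 := h.rec_succ j hj n
        have e2 := h'.rec_succ j hj n
        refine ⟨PowerSeries.X ^ n * (a + b) - PowerSeries.X ^ (2 * n + 1) * c, ?_⟩
        linear_combination e1 - e2 + e + PowerSeries.X ^ (n + 1) * (ha + hb) -
          PowerSeries.X ^ (2 * (n + 1)) * hc
    intro j hj
    exact sub_eq_zero.1 (eq_zero_of_forall_X_pow_dvd fun m => key m j hj)

/-! ### The Burge-type transform -/

/-- Convolution with `1 / (q; q)_n`. -/
def convPoch (h : ℕ → ℤ⟦X⟧) (n : ℕ) : ℤ⟦X⟧ :=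
  ∑ m ∈ Finset.range (n + 1), h m * recipPoch 1 (n - m)

theorem sum_mul_one_sub_mul_recipPoch (h : ℕ → ℤ⟦X⟧) (n : ℕ) :
    ∑ m ∈ Finset.range (n + 2),
      h m * ((1 - PowerSeries.X ^ (n + 1 - m)) * recipPoch 1 (n + 1 - m)) = convPoch h n := by
  rw [Finset.sum_range_succ, convPoch]
  simp only [Nat.sub_self, pow_zero, sub_self, zero_mul, mul_zero, add_zero]
  refine Finset.sum_congr rfl fun m hm => ?_
  have hm' : m ≤ n := Nat.lt_succ_iff.1 (Finset.mem_range.1 hm)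
  rw [Nat.succ_sub hm', ← recipPoch_succ one_ne_zero (n - m), one_mul]

/-- The transform from level `d` to level `d + 2`. Since `extendFamily` shifts the index by one,
the `j`-th member of the new family is built from the member `j - 1` of the old one. -/
def burge (d : ℕ) (T : ℕ → ℕ → ℤ⟦X⟧) (j : ℕ) : ℕ → ℤ⟦X⟧ :=
  convPoch fun m => PowerSeries.X ^ (m ^ 2) * extendFamily d T j m

/-- The recursion at an end of the family. -/
theorem convPoch_boundary (u : ℕ → ℤ⟦X⟧) (n : ℕ) :
    convPoch (fun m => PowerSeries.X ^ (m ^ 2) * (PowerSeries.X ^ m * u m)) (n + 1) =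
      convPoch (fun m => PowerSeries.X ^ (m ^ 2) * (PowerSeries.X ^ m * u m)) n +
      PowerSeries.X ^ (n + 1) * convPoch (fun m => PowerSeries.X ^ (m ^ 2) * u m) (n + 1) := by
  rw [← sum_mul_one_sub_mul_recipPoch _ n, convPoch, convPoch, Finset.mul_sum,
    ← Finset.sum_add_distrib]
  refine Finset.sum_congr rfl fun m hm => ?_
  have hm' : m ≤ n + 1 := Nat.lt_succ_iff.1 (Finset.mem_range.1 hm)
  obtain ⟨c, hc⟩ := Nat.exists_eq_add_of_le hm'
  rw [hc, Nat.add_sub_cancel_left]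
  ring

/-- The recursion away from the ends: multiplied by `q ^ (m² + (n - m)) / (q; q)_{n - m}` and
summed over `m`, the recursion for `u` telescopes to the one for its transform, by
`1 + q^{2n} - q^{n-m} (1 + q^{2m}) = (1 - q^{n-m}) (1 - q^{n+m})`. -/
theorem convPoch_interior (u v : ℕ → ℤ⟦X⟧) (h0 : v 0 = 2 * u 0)
    (h : ∀ n, u (n + 1) = u n + PowerSeries.X ^ (n + 1) * v (n + 1) -
      PowerSeries.X ^ (2 * (n + 1)) * u (n + 1)) (n : ℕ) :
    convPoch (fun m => PowerSeries.X ^ (m ^ 2) * u m) (n + 1) =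
      convPoch (fun m => PowerSeries.X ^ (m ^ 2) * u m) n +
      PowerSeries.X ^ (n + 1) * convPoch (fun m => PowerSeries.X ^ (m ^ 2) * v m) (n + 1) -
      PowerSeries.X ^ (2 * (n + 1)) *
        convPoch (fun m => PowerSeries.X ^ (m ^ 2) * u m) (n + 1) := by
  -- `w m = u (m - 1)`, with `u (-1) = 0`
  obtain ⟨w, hw0, hw⟩ : ∃ w : ℕ → ℤ⟦X⟧, w 0 = 0 ∧ ∀ m, w (m + 1) = u m :=
    ⟨fun m => Nat.casesOn m 0 u, rfl, fun _ => rfl⟩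
  have hv : ∀ m, PowerSeries.X ^ m * v m = (1 + PowerSeries.X ^ (2 * m)) * u m - w m := by
    intro m
    cases m with
    | zero => rw [hw0, h0]; ring
    | succ m => rw [hw]; linear_combination -(h m)
  have e1 : (1 + PowerSeries.X ^ (2 * (n + 1))) *
        convPoch (fun m => PowerSeries.X ^ (m ^ 2) * u m) (n + 1) -
      PowerSeries.X ^ (n + 1) * convPoch (fun m => PowerSeries.X ^ (m ^ 2) * v m) (n + 1) =
      ∑ m ∈ Finset.range (n + 2),
        (PowerSeries.X ^ (m ^ 2) * (1 - PowerSeries.X ^ (n + 1 + m)) * u m) *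
          ((1 - PowerSeries.X ^ (n + 1 - m)) * recipPoch 1 (n + 1 - m)) +
      ∑ m ∈ Finset.range (n + 2),
        PowerSeries.X ^ (m ^ 2 + (n + 1 - m)) * w m * recipPoch 1 (n + 1 - m) := by
    rw [convPoch, convPoch, Finset.mul_sum, Finset.mul_sum, ← Finset.sum_sub_distrib,
      ← Finset.sum_add_distrib]
    refine Finset.sum_congr rfl fun m hm => ?_
    have hm' : m ≤ n + 1 := Nat.lt_succ_iff.1 (Finset.mem_range.1 hm)
    obtain ⟨c, hc⟩ := Nat.exists_eq_add_of_le hm'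
    rw [hc, Nat.add_sub_cancel_left]
    linear_combination -(PowerSeries.X ^ (m ^ 2 + c) * recipPoch 1 c) * hv m
  have e2 : ∑ m ∈ Finset.range (n + 2),
        PowerSeries.X ^ (m ^ 2 + (n + 1 - m)) * w m * recipPoch 1 (n + 1 - m) =
      ∑ m ∈ Finset.range (n + 1),
        PowerSeries.X ^ (m ^ 2) * PowerSeries.X ^ (n + 1 + m) * u m * recipPoch 1 (n - m) := by
    rw [Finset.sum_range_succ', hw0, mul_zero, zero_mul, add_zero]
    refine Finset.sum_congr rfl fun m hm => ?_
    have hm' : m ≤ n := Nat.lt_succ_iff.1 (Finset.mem_range.1 hm)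
    obtain ⟨c, rfl⟩ := Nat.exists_eq_add_of_le hm'
    rw [hw, Nat.add_sub_add_right, Nat.add_sub_cancel_left]
    ring
  have e3 : convPoch (fun m => PowerSeries.X ^ (m ^ 2) * u m) n =
      convPoch (fun m => PowerSeries.X ^ (m ^ 2) * (1 - PowerSeries.X ^ (n + 1 + m)) * u m) n +
      ∑ m ∈ Finset.range (n + 1),
        PowerSeries.X ^ (m ^ 2) * PowerSeries.X ^ (n + 1 + m) * u m * recipPoch 1 (n - m) := by
    rw [convPoch, convPoch, ← Finset.sum_add_distrib]
    exact Finset.sum_congr rfl fun m _ => by ring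
  rw [sum_mul_one_sub_mul_recipPoch, e2] at e1
  linear_combination e1 - e3

theorem convPoch_zero (h : ℕ → ℤ⟦X⟧) : convPoch h 0 = h 0 := by
  simp [convPoch, recipPoch_zero]

theorem IsBoundedGF.extendFamily_zero {d : ℕ} {T : ℕ → ℕ → ℤ⟦X⟧} (h : IsBoundedGF d T) (j : ℕ) :
    extendFamily d T j 0 = 1 := by
  cases j with
  | zero => simp [extendFamily, h.init]
  | succ j =>
    simp only [extendFamily]
    split_ifs with hj
    · exact h.init j hj
    · simp [h.init]

theorem extendFamily_of_le {d j : ℕ} (hj : j ≤ d) (T : ℕ → ℕ → ℤ⟦X⟧) (n : ℕ) :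
    extendFamily d T (j + 1) n = T j n := if_pos hj

theorem extendFamily_last (d : ℕ) (T : ℕ → ℕ → ℤ⟦X⟧) (n : ℕ) :
    extendFamily d T (d + 2) n = PowerSeries.X ^ n * T d n := if_neg (by omega)

theorem IsBoundedGF.burge {d : ℕ} {T : ℕ → ℕ → ℤ⟦X⟧} (h : IsBoundedGF d T) :
    IsBoundedGF (d + 2) (burge d T) where
  init j _ := by
    rw [_root_.burge, convPoch_zero, h.extendFamily_zero]
    simp
  rec_succ j hj n := by
    rcases Nat.eq_zero_or_pos j with rfl | hj0
    · rw [extendFamily_of_le (by omega), extendFamily]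
      have hb := convPoch_boundary (T 0) n
      have e0 : _root_.burge d T 0 =
          convPoch fun m => PowerSeries.X ^ (m ^ 2) * (PowerSeries.X ^ m * T 0 m) := rfl
      have e1 : _root_.burge d T 1 = convPoch fun m => PowerSeries.X ^ (m ^ 2) * T 0 m := by
        simp only [_root_.burge, extendFamily_of_le (Nat.zero_le d)]
      rw [← e0, ← e1] at hb
      linear_combination hb
    · obtain ⟨j, rfl⟩ := Nat.exists_eq_succ_of_ne_zero hj0.ne'
      rw [Nat.succ_eq_add_one] at *
      rw [extendFamily_of_le (by omega)]
      rcases (show j ≤ d ∨ j = d + 1 by omega) with hjd | rfl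
      · have hi := convPoch_interior (T j)
          (fun m => extendFamily d T j m + extendFamily d T (j + 2) m)
          (by
            show extendFamily d T j 0 + extendFamily d T (j + 2) 0 = 2 * T j 0
            rw [h.extendFamily_zero, h.extendFamily_zero, h.init j hjd]; norm_num)
          (h.rec_succ j hjd) n
        have e0 : _root_.burge d T (j + 1) =
            convPoch fun m => PowerSeries.X ^ (m ^ 2) * T j m := by
          simp only [_root_.burge, extendFamily_of_le hjd]
        have e1 : convPoch (fun m => PowerSeries.X ^ (m ^ 2) *
              (extendFamily d T j m + extendFamily d T (j + 2) m)) (n + 1) =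
            _root_.burge d T j (n + 1) + _root_.burge d T (j + 2) (n + 1) := by
          simp only [_root_.burge, convPoch, mul_add, add_mul, Finset.sum_add_distrib]
        rw [e1, ← e0] at hi
        rw [extendFamily_of_le (j := j + 2) (by omega)]
        exact hi
      · rw [extendFamily_last]
        have hb := convPoch_boundary (T d) n
        have e0 : _root_.burge d T (d + 2) =
            convPoch fun m => PowerSeries.X ^ (m ^ 2) * (PowerSeries.X ^ m * T d m) := by
          simp only [_root_.burge, extendFamily_last]
        have e1 : _root_.burge d T (d + 1) = convPoch fun m => PowerSeries.X ^ (m ^ 2) * T d m := by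
          simp only [_root_.burge, extendFamily_of_le (le_refl d)]
        rw [← e0, ← e1] at hb
        linear_combination hb

/-! ### Iterating the transform -/

/-- The `k`-fold transform of `1 / (q^f; q^f)_n`; for `f = 1, 2` it belongs to the level
`2 - f + 2 * k`. -/
def burgeIter (f : ℕ) : ℕ → ℕ → ℕ → ℤ⟦X⟧
  | 0, _, n => recipPoch f n
  | k + 1, j, n => burge (2 - f + 2 * k) (burgeIter f k) j n

theorem isBoundedGF_burgeIter {f : ℕ} (hf : f = 1 ∨ f = 2) (k : ℕ) :
    IsBoundedGF (2 - f + 2 * k) (burgeIter f k) := by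
  induction k with
  | zero =>
    refine ⟨fun j _ => recipPoch_zero f, fun j hj n => ?_⟩
    rcases hf with rfl | rfl
    · have hr := recipPoch_succ one_ne_zero n
      rcases (show j = 0 ∨ j = 1 by omega) with rfl | rfl <;>
      · simp only [extendFamily, burgeIter]
        norm_num
        linear_combination hr
    · have hr := recipPoch_succ two_ne_zero n
      obtain rfl : j = 0 := by omega
      simp only [extendFamily, burgeIter]
      norm_num
      linear_combination hr
  | succ k ih => exact ih.burge

/-! ### Generating functions of sets of arrays -/

theorem cpNorm_add {r : ℕ} (π π' : Fin r × ℕ →₀ ℕ) : cpNorm (π + π') = cpNorm π + cpNorm π' :=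
  Finsupp.sum_add_index' (fun _ => rfl) (fun _ _ _ => rfl)

theorem cpNorm_single {r : ℕ} (p : Fin r × ℕ) (n : ℕ) : cpNorm (Finsupp.single p n) = n :=
  Finsupp.sum_single_index rfl

theorem cpNorm_mapDomain {r : ℕ} (f : Fin r × ℕ → Fin r × ℕ) (π : Fin r × ℕ →₀ ℕ) :
    cpNorm (π.mapDomain f) = cpNorm π :=
  Finsupp.sum_mapDomain_index (fun _ => rfl) (fun _ _ _ => rfl)

theorem le_cpNorm {r : ℕ} (π : Fin r × ℕ →₀ ℕ) (p : Fin r × ℕ) : π p ≤ cpNorm π := by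
  by_cases hp : p ∈ π.support
  · exact Finset.single_le_sum (f := fun p => π p) (fun _ _ => Nat.zero_le _) hp
  · rw [Finsupp.notMem_support_iff.1 hp]
    exact Nat.zero_le _

/-- A non-zero entry in column `j` of row `s` is the last of `j - μ s` positive entries of its row,
each of which contributes at least `1` to the norm. -/
theorem IsCylindricPartition.le_add_cpNorm {r : ℕ} {μ : Fin r → ℕ} {d : ℕ}
    {π : Fin r × ℕ →₀ ℕ} (h : IsCylindricPartition μ d π) {s : Fin r} {j : ℕ}
    (hj : π (s, j) ≠ 0) : j ≤ μ s + cpNorm π := by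
  have hpos : ∀ c, μ s < j - c → π (s, j - c) ≠ 0 := by
    intro c
    induction c with
    | zero => exact fun _ => hj
    | succ c ih =>
      intro hc
      have hr := h.row s (j - (c + 1)) hc
      rw [show j - (c + 1) + 1 = j - c by omega] at hr
      have := ih (by omega)
      omega
  have hsub : (Finset.Ioc (μ s) j).image (fun j => (s, j)) ⊆ π.support := by
    intro p hp
    obtain ⟨a, ha, rfl⟩ := Finset.mem_image.1 hp
    rw [Finset.mem_Ioc] at ha
    have := hpos (j - a) (by omega)
    rw [Finsupp.mem_support_iff]
    rwa [show j - (j - a) = a by omega] at this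
  have hcard := Finset.card_le_card hsub
  rw [Finset.card_image_of_injective _ (Prod.mk_right_injective s), Nat.card_Ioc] at hcard
  have hsum : π.support.card ≤ cpNorm π := by
    rw [Finset.card_eq_sum_ones]
    exact Finset.sum_le_sum fun p hp => Nat.one_le_iff_ne_zero.2 (Finsupp.mem_support_iff.1 hp)
  omega

theorem finite_cylindricPartitions_cpNorm {r : ℕ} (m : Fin r → ℕ) (N : ℕ) :
    (cylindricPartitions m ∩ {π | cpNorm π = N}).Finite := by
  refine ((Finset.finsupp
    (Finset.univ ×ˢ Finset.range (Finset.univ.sup (weightPartition m) + N + 1))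
    fun _ => Finset.range (N + 1)).finite_toSet).subset ?_
  rintro π ⟨hπ, rfl⟩
  rw [Finset.mem_coe, Finset.mem_finsupp_iff]
  constructor
  · rintro ⟨s, j⟩ hp
    have h1 := hπ.le_add_cpNorm (Finsupp.mem_support_iff.1 hp)
    have h2 : weightPartition m s ≤ Finset.univ.sup (weightPartition m) :=
      Finset.le_sup (Finset.mem_univ s)
    rw [Finset.mem_product, Finset.mem_range]
    exact ⟨Finset.mem_univ _, by simp only; omega⟩
  · exact fun p _ => Finset.mem_range.2 (Nat.lt_succ_iff.2 (le_cpNorm π p))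

/-- The generating function of a set of arrays by their norm. The coefficients are meaningful
only if there are finitely many arrays of each norm. -/
def arrayGF {r : ℕ} (S : Set (Fin r × ℕ →₀ ℕ)) : ℤ⟦X⟧ :=
  PowerSeries.mk fun N => ((S ∩ {π | cpNorm π = N}).ncard : ℤ)

theorem arrayGF_union_add_inter {r : ℕ} {S T : Set (Fin r × ℕ →₀ ℕ)}
    (hS : ∀ N, (S ∩ {π | cpNorm π = N}).Finite) (hT : ∀ N, (T ∩ {π | cpNorm π = N}).Finite) :
    arrayGF (S ∪ T) + arrayGF (S ∩ T) = arrayGF S + arrayGF T := by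
  ext N
  simp only [arrayGF, map_add, PowerSeries.coeff_mk]
  rw [Set.union_inter_distrib_right, Set.inter_inter_distrib_right]
  exact_mod_cast Set.ncard_union_add_ncard_inter _ _ (hS N) (hT N)

theorem arrayGF_union {r : ℕ} {S T : Set (Fin r × ℕ →₀ ℕ)} (hST : Disjoint S T)
    (hS : ∀ N, (S ∩ {π | cpNorm π = N}).Finite) (hT : ∀ N, (T ∩ {π | cpNorm π = N}).Finite) :
    arrayGF (S ∪ T) = arrayGF S + arrayGF T := by
  rw [← arrayGF_union_add_inter hS hT, hST.inter_eq]
  have : arrayGF (∅ : Set (Fin r × ℕ →₀ ℕ)) = 0 := by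
    ext N
    simp [arrayGF]
  rw [this, add_zero]

theorem arrayGF_image {r w : ℕ} {g : (Fin r × ℕ →₀ ℕ) → Fin r × ℕ →₀ ℕ}
    (hg : Function.Injective g) (hw : ∀ π, cpNorm (g π) = w + cpNorm π)
    (S : Set (Fin r × ℕ →₀ ℕ)) : arrayGF (g '' S) = PowerSeries.X ^ w * arrayGF S := by
  ext N
  simp only [arrayGF, PowerSeries.coeff_X_pow_mul', PowerSeries.coeff_mk]
  split_ifs with hN
  · have : g '' S ∩ {π | cpNorm π = N} = g '' (S ∩ {π | cpNorm π = N - w}) := by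
      rw [← Set.image_inter_preimage]
      congr 2
      ext π
      simp only [Set.mem_preimage, Set.mem_ofPred_eq, hw]
      omega
    rw [this, Set.ncard_image_of_injective _ hg]
  · have : g '' S ∩ {π | cpNorm π = N} = ∅ := by
      refine Set.eq_empty_of_forall_notMem ?_
      rintro _ ⟨⟨π, -, rfl⟩, hπ⟩
      have := hw π
      rw [Set.mem_ofPred_eq] at hπ
      omega
    rw [this]
    simp

/-! ### Removing the first entry of a row -/

theorem mem_cylindricPartitions_iff {d i : ℕ} (hi : i ≤ d) {π : Fin 2 × ℕ →₀ ℕ} :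
    π ∈ cylindricPartitions ![d - i, i] ↔
      ((∀ j, j ≤ i → π (0, j) = 0) ∧ π (1, 0) = 0) ∧
      ((∀ j, i < j → π (0, j + 1) ≤ π (0, j)) ∧ ∀ j, 0 < j → π (1, j + 1) ≤ π (1, j)) ∧
      (∀ j, i < j → π (1, j) ≤ π (0, j)) ∧ ∀ j, 0 < j → π (0, j + d) ≤ π (1, j) := by
  have h0 : weightPartition ![d - i, i] 0 = i := by
    simp [weightPartition, show Finset.Ioi (0 : Fin 2) = {1} from rfl]
  have h1 : weightPartition ![d - i, i] 1 = 0 := by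
    simp [weightPartition, show Finset.Ioi (1 : Fin 2) = ∅ from rfl]
  have hl : weightLevel ![d - i, i] = d := by
    simp [weightLevel, hi]
  constructor
  · intro h
    have hc := h.cyl 1 0 rfl rfl
    rw [h0, h1, hl] at hc
    have hcol := h.col 0 1 rfl
    rw [h0, h1] at hcol
    have ho0 := h.outside 0
    have ho1 := h.outside 1
    have hr0 := h.row 0
    have hr1 := h.row 1
    rw [h0] at ho0 hr0
    rw [h1] at ho1 hr1
    exact ⟨⟨ho0, ho1 0 le_rfl⟩, ⟨hr0, hr1⟩, fun j hj => hcol j (by omega),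
      fun j hj => hc j hj (by omega)⟩
  · rintro ⟨⟨ho0, ho1⟩, ⟨hr0, hr1⟩, hcol, hc⟩
    refine ⟨?_, ?_, ?_, ?_⟩
    · rw [Fin.forall_fin_two, h0, h1]
      exact ⟨ho0, fun j hj => by rw [Nat.le_zero.1 hj, ho1]⟩
    · rw [Fin.forall_fin_two, h0, h1]
      exact ⟨hr0, hr1⟩
    · intro s t hst j hj
      obtain rfl : s = 0 := Fin.ext (by simp only [Fin.val_zero]; omega)
      obtain rfl : t = 1 := Fin.ext (by simpa using hst)
      rw [h0, h1] at hj
      exact hcol j (by omega)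
    · intro s t hs ht j hj _
      obtain rfl : s = 1 := Fin.ext (by simp only [Fin.val_one]; omega)
      obtain rfl : t = 0 := Fin.ext ht
      rw [h1] at hj
      rw [hl]
      exact hc j hj

/-- The cylindric partitions of profile `[d - i, i]` with entries at most `n`. -/
def boundedCP (d i n : ℕ) : Set (Fin 2 × ℕ →₀ ℕ) :=
  {π | π ∈ cylindricPartitions ![d - i, i] ∧ ∀ p, π p ≤ n}

theorem finite_boundedCP_cpNorm (d i n N : ℕ) (P : Set (Fin 2 × ℕ →₀ ℕ)) :
    ((boundedCP d i n ∩ P) ∩ {π | cpNorm π = N}).Finite :=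
  (finite_cylindricPartitions_cpNorm ![d - i, i] N).subset
    fun _ h => ⟨h.1.1.1, h.2⟩

/-- The largest entry is the first one of some row. -/
theorem apply_le_of_mem_cylindricPartitions {d i n : ℕ} (hi : i ≤ d) {π : Fin 2 × ℕ →₀ ℕ}
    (h : π ∈ cylindricPartitions ![d - i, i]) (h0 : π (0, i + 1) ≤ n) (h1 : π (1, 1) ≤ n)
    (p : Fin 2 × ℕ) : π p ≤ n := by
  obtain ⟨⟨ho0, ho1⟩, ⟨hr0, hr1⟩, -, -⟩ := (mem_cylindricPartitions_iff hi).1 h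
  have a0 : ∀ c, π (0, i + 1 + c) ≤ n := by
    intro c
    induction c with
    | zero => exact h0
    | succ c ih => exact (hr0 (i + 1 + c) (by omega)).trans ih
  have a1 : ∀ c, π (1, 1 + c) ≤ n := by
    intro c
    induction c with
    | zero => exact h1
    | succ c ih => exact (hr1 (1 + c) (by omega)).trans ih
  obtain ⟨s, j⟩ := p
  revert s
  rw [Fin.forall_fin_two]
  constructor
  · rcases Nat.lt_or_ge i j with hj | hj
    · obtain ⟨c, rfl⟩ := Nat.exists_eq_add_of_le hj
      exact a0 c
    · rw [ho0 j hj]; exact Nat.zero_le n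
  · rcases Nat.eq_zero_or_pos j with rfl | hj
    · rw [ho1]; exact Nat.zero_le n
    · obtain ⟨c, rfl⟩ := Nat.exists_eq_add_of_le (show 1 ≤ j from hj)
      exact a1 c

/-- Put the entry `n` into column `i + 1` of the first row, which is empty for the profile
`[d - (i + 1), i + 1]` and the first one of its row for `[d - i, i]`. -/
def addTop (i n : ℕ) (π : Fin 2 × ℕ →₀ ℕ) : Fin 2 × ℕ →₀ ℕ :=
  Finsupp.single (0, i + 1) n + π

theorem addTop_injective (i n : ℕ) : Function.Injective (addTop i n) :=
  add_right_injective _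

theorem cpNorm_addTop (i n : ℕ) (π : Fin 2 × ℕ →₀ ℕ) :
    cpNorm (addTop i n π) = n + cpNorm π := by
  rw [addTop, cpNorm_add, cpNorm_single]

theorem addTop_apply_zero (i n j : ℕ) (π : Fin 2 × ℕ →₀ ℕ) :
    addTop i n π (0, j) = (if j = i + 1 then n else 0) + π (0, j) := by
  simp [addTop, Finsupp.single_apply, eq_comm]

theorem addTop_apply_one (i n j : ℕ) (π : Fin 2 × ℕ →₀ ℕ) :
    addTop i n π (1, j) = π (1, j) := by
  simp [addTop]

theorem image_addTop {d i n : ℕ} (hi : i + 1 ≤ d) :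
    addTop i n '' boundedCP d (i + 1) n = boundedCP d i n ∩ {π | π (0, i + 1) = n} := by
  ext π
  constructor
  · rintro ⟨π, ⟨h, hn⟩, rfl⟩
    obtain ⟨⟨ho0, ho1⟩, ⟨hr0, hr1⟩, hcol, hc⟩ := (mem_cylindricPartitions_iff hi).1 h
    have htop : addTop i n π (0, i + 1) = n := by
      rw [addTop_apply_zero, if_pos rfl, ho0 _ le_rfl, add_zero]
    have hne : ∀ j, j ≠ i + 1 → addTop i n π (0, j) = π (0, j) := fun j hj => by
      rw [addTop_apply_zero, if_neg hj, zero_add]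
    have hmem : addTop i n π ∈ cylindricPartitions ![d - i, i] := by
      rw [mem_cylindricPartitions_iff (by omega)]
      simp only [addTop_apply_one]
      refine ⟨⟨fun j hj => ?_, ho1⟩, ⟨fun j hj => ?_, hr1⟩, fun j hj => ?_, fun j hj => ?_⟩
      · rw [hne j (by omega), ho0 j (by omega)]
      · rw [hne (j + 1) (by omega)]
        by_cases hj' : j = i + 1
        · rw [hj', htop]; exact hn _
        · rw [hne j hj']; exact hr0 j (by omega)
      · by_cases hj' : j = i + 1
        · rw [hj', htop]; exact hn _
        · rw [hne j hj']; exact hcol j (by omega)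
      · rw [hne (j + d) (by omega)]; exact hc j hj
    refine ⟨⟨hmem, apply_le_of_mem_cylindricPartitions (by omega) hmem htop.le ?_⟩, htop⟩
    rw [addTop_apply_one]; exact hn _
  · rintro ⟨⟨h, hn⟩, htop⟩
    obtain ⟨⟨ho0, ho1⟩, ⟨hr0, hr1⟩, hcol, hc⟩ :=
      (mem_cylindricPartitions_iff (by omega)).1 h
    rw [Set.mem_ofPred_eq] at htop
    have h0 : π.erase (0, i + 1) (0, i + 1) = 0 := Finsupp.erase_same
    have hne : ∀ j, j ≠ i + 1 → π.erase (0, i + 1) (0, j) = π (0, j) := fun j hj =>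
      Finsupp.erase_ne (by simpa using hj)
    have h1 : ∀ j, π.erase (0, i + 1) (1, j) = π (1, j) := fun j =>
      Finsupp.erase_ne (by simp)
    have hmem : π.erase (0, i + 1) ∈ cylindricPartitions ![d - (i + 1), i + 1] := by
      rw [mem_cylindricPartitions_iff hi]
      simp only [h1]
      refine ⟨⟨fun j hj => ?_, ho1⟩, ⟨fun j hj => ?_, hr1⟩, fun j hj => ?_, fun j hj => ?_⟩
      · by_cases hj' : j = i + 1
        · rw [hj', h0]
        · rw [hne j hj', ho0 j (by omega)]
      · rw [hne (j + 1) (by omega), hne j (by omega)]; exact hr0 j (by omega)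
      · rw [hne j (by omega)]; exact hcol j (by omega)
      · rw [hne (j + d) (by omega)]; exact hc j hj
    refine ⟨π.erase (0, i + 1), ⟨hmem, fun p => ?_⟩, ?_⟩
    · by_cases hp : p = (0, i + 1)
      · rw [hp, h0]; exact Nat.zero_le n
      · rw [Finsupp.erase_ne hp]; exact hn p
    · rw [addTop, ← htop, Finsupp.single_add_erase]

/-- Shift of the columns by one. -/
def shiftCol (p : Fin 2 × ℕ) : Fin 2 × ℕ := (p.1, p.2 + 1)

theorem shiftCol_injective : Function.Injective shiftCol := by
  rintro ⟨s, j⟩ ⟨t, l⟩ h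
  simpa [shiftCol] using h

/-- Shift the columns by one and put the entry `n` at the start of the second row. The shift turns
the profile `[d - i, i]` into `[d - (i + 1), i + 1]`. -/
def addBottom (n : ℕ) (π : Fin 2 × ℕ →₀ ℕ) : Fin 2 × ℕ →₀ ℕ :=
  Finsupp.single (1, 1) n + π.mapDomain shiftCol

theorem addBottom_injective (n : ℕ) : Function.Injective (addBottom n) :=
  (add_right_injective _).comp (Finsupp.mapDomain_injective shiftCol_injective)

theorem cpNorm_addBottom (n : ℕ) (π : Fin 2 × ℕ →₀ ℕ) :
    cpNorm (addBottom n π) = n + cpNorm π := by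
  rw [addBottom, cpNorm_add, cpNorm_single, cpNorm_mapDomain]

theorem mapDomain_shiftCol_zero (s : Fin 2) (π : Fin 2 × ℕ →₀ ℕ) :
    π.mapDomain shiftCol (s, 0) = 0 :=
  Finsupp.mapDomain_of_notMem_range _ _ (by rintro ⟨p, hp⟩; simp [shiftCol] at hp)

theorem mapDomain_shiftCol_succ (s : Fin 2) (j : ℕ) (π : Fin 2 × ℕ →₀ ℕ) :
    π.mapDomain shiftCol (s, j + 1) = π (s, j) :=
  Finsupp.mapDomain_apply shiftCol_injective π (s, j)

theorem image_addBottom {d i n : ℕ} (hi : i + 1 ≤ d) :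
    addBottom n '' boundedCP d i n = boundedCP d (i + 1) n ∩ {π | π (1, 1) = n} := by
  ext π
  constructor
  · rintro ⟨π, ⟨h, hn⟩, rfl⟩
    obtain ⟨⟨ho0, ho1⟩, ⟨hr0, hr1⟩, hcol, hc⟩ :=
      (mem_cylindricPartitions_iff (by omega)).1 h
    have a0 : addBottom n π (0, 0) = 0 := by
      simp [addBottom, mapDomain_shiftCol_zero]
    have a1 : ∀ j, addBottom n π (0, j + 1) = π (0, j) := fun j => by
      simp [addBottom, mapDomain_shiftCol_succ]
    have b0 : addBottom n π (1, 0) = 0 := by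
      simp [addBottom, mapDomain_shiftCol_zero]
    have b1 : addBottom n π (1, 1) = n := by
      simp [addBottom, mapDomain_shiftCol_succ _ 0, ho1]
    have b2 : ∀ j, 0 < j → addBottom n π (1, j + 1) = π (1, j) := fun j hj => by
      simp [addBottom, mapDomain_shiftCol_succ, Finsupp.single_apply]
      omega
    have hmem : addBottom n π ∈ cylindricPartitions ![d - (i + 1), i + 1] := by
      rw [mem_cylindricPartitions_iff hi]
      refine ⟨⟨fun j hj => ?_, b0⟩, ⟨fun j hj => ?_, fun j hj => ?_⟩,
        fun j hj => ?_, fun j hj => ?_⟩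
      · cases j with
        | zero => exact a0
        | succ j => rw [a1]; exact ho0 j (by omega)
      · obtain ⟨j, rfl⟩ := Nat.exists_eq_succ_of_ne_zero (by omega : j ≠ 0)
        rw [Nat.succ_eq_add_one, a1, a1]; exact hr0 j (by omega)
      · rw [b2 j hj]
        obtain ⟨j, rfl⟩ := Nat.exists_eq_succ_of_ne_zero hj.ne'
        rcases Nat.eq_zero_or_pos j with rfl | hj'
        · rw [Nat.succ_eq_add_one, zero_add, b1]; exact hn _
        · rw [Nat.succ_eq_add_one, b2 j hj']; exact hr1 j hj'
      · obtain ⟨j, rfl⟩ := Nat.exists_eq_succ_of_ne_zero (by omega : j ≠ 0)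
        rw [Nat.succ_eq_add_one, a1, b2 j (by omega)]; exact hcol j (by omega)
      · obtain ⟨j, rfl⟩ := Nat.exists_eq_succ_of_ne_zero hj.ne'
        rw [Nat.succ_eq_add_one, Nat.add_right_comm, a1]
        rcases Nat.eq_zero_or_pos j with rfl | hj'
        · rw [zero_add, zero_add, b1]; exact hn _
        · rw [b2 j hj']; exact hc j hj'
    refine ⟨⟨hmem, apply_le_of_mem_cylindricPartitions hi hmem ?_ b1.le⟩, b1⟩
    rw [a1]; exact hn _
  · rintro ⟨⟨h, hn⟩, htop⟩
    obtain ⟨⟨ho0, ho1⟩, ⟨hr0, hr1⟩, hcol, hc⟩ := (mem_cylindricPartitions_iff hi).1 h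
    rw [Set.mem_ofPred_eq] at htop
    set π' := (π.erase (1, 1)).comapDomain shiftCol shiftCol_injective.injOn with hπ'
    have a1 : ∀ j, π' (0, j) = π (0, j + 1) := fun j =>
      Finsupp.erase_ne (by simp [shiftCol])
    have b0 : π' (1, 0) = 0 := Finsupp.erase_same
    have b1 : ∀ j, 0 < j → π' (1, j) = π (1, j + 1) := fun j hj =>
      Finsupp.erase_ne (by simpa [shiftCol] using hj.ne')
    have hmem : π' ∈ cylindricPartitions ![d - i, i] := by
      rw [mem_cylindricPartitions_iff (by omega)]
      simp only [a1]
      refine ⟨⟨fun j hj => ho0 _ (by omega), b0⟩, ⟨fun j hj => hr0 _ (by omega), fun j hj => ?_⟩,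
        fun j hj => ?_, fun j hj => ?_⟩
      · rw [b1 j hj, b1 _ (by omega)]; exact hr1 _ (by omega)
      · rw [b1 j (by omega)]; exact hcol _ (by omega)
      · rw [b1 j hj, Nat.add_right_comm]; exact hc _ (by omega)
    refine ⟨π', ⟨hmem, apply_le_of_mem_cylindricPartitions (by omega) hmem ?_ ?_⟩, ?_⟩
    · rw [a1]; exact hn _
    · rw [b1 1 one_pos]; exact hn _
    · rw [addBottom, hπ', Finsupp.mapDomain_comapDomain _ shiftCol_injective, ← htop,
        Finsupp.single_add_erase]
      rintro ⟨s, j⟩ hp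
      cases j with
      | zero =>
        exfalso
        refine Finsupp.mem_support_iff.1 hp ?_
        rw [Finsupp.erase_ne (by simp)]
        revert s
        rw [Fin.forall_fin_two]
        exact ⟨fun _ => ho0 0 (Nat.zero_le _), fun _ => ho1⟩
      | succ j => exact ⟨(s, j), rfl⟩

/-! ### The recursion for cylindric partitions with bounded entries -/

theorem boundedCP_zero {d i : ℕ} (hi : i ≤ d) : boundedCP d i 0 = {0} := by
  ext π
  constructor
  · rintro ⟨-, h⟩
    exact Finsupp.ext fun p => Nat.le_zero.1 (h p)
  · rintro rfl
    refine ⟨?_, fun _ => le_rfl⟩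
    rw [mem_cylindricPartitions_iff hi]
    simp

theorem arrayGF_singleton_zero : arrayGF ({0} : Set (Fin 2 × ℕ →₀ ℕ)) = 1 := by
  ext N
  rw [arrayGF, PowerSeries.coeff_mk, PowerSeries.coeff_one]
  have h0 : cpNorm (0 : Fin 2 × ℕ →₀ ℕ) = 0 := Finsupp.sum_zero_index
  split_ifs with hN
  · rw [Set.inter_eq_left.2 (by simp [h0, hN]), Set.ncard_singleton]; rfl
  · rw [Set.singleton_inter_eq_empty.2 (by rw [Set.mem_ofPred_eq, h0]; exact Ne.symm hN)]
    simp

theorem boundedCP_succ {d i n : ℕ} (hi : i ≤ d) :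
    boundedCP d i (n + 1) = boundedCP d i n ∪
      (boundedCP d i (n + 1) ∩ {π | π (0, i + 1) = n + 1} ∪
        boundedCP d i (n + 1) ∩ {π | π (1, 1) = n + 1}) := by
  ext π
  constructor
  · rintro ⟨h, hn⟩
    by_cases h0 : π (0, i + 1) = n + 1
    · exact Or.inr (Or.inl ⟨⟨h, hn⟩, h0⟩)
    by_cases h1 : π (1, 1) = n + 1
    · exact Or.inr (Or.inr ⟨⟨h, hn⟩, h1⟩)
    have b0 := hn (0, i + 1)
    have b1 := hn (1, 1)
    exact Or.inl ⟨h, apply_le_of_mem_cylindricPartitions hi h (by omega) (by omega)⟩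
  · rintro (⟨h, hn⟩ | h | h)
    · exact ⟨h, fun p => (hn p).trans (Nat.le_succ n)⟩
    · exact h.1
    · exact h.1

theorem arrayGF_boundedCP_succ {d i n : ℕ} (hi : i ≤ d) :
    arrayGF (boundedCP d i (n + 1)) = arrayGF (boundedCP d i n) +
      arrayGF (boundedCP d i (n + 1) ∩ {π | π (0, i + 1) = n + 1} ∪
        boundedCP d i (n + 1) ∩ {π | π (1, 1) = n + 1}) := by
  conv_lhs => rw [boundedCP_succ hi]
  refine arrayGF_union ?_ (fun N => ?_) fun N => ?_
  · rw [Set.disjoint_left]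
    rintro π ⟨-, hn⟩ (⟨-, h⟩ | ⟨-, h⟩)
    · have := hn (0, i + 1)
      rw [Set.mem_ofPred_eq] at h
      omega
    · have := hn (1, 1)
      rw [Set.mem_ofPred_eq] at h
      omega
  · simpa using finite_boundedCP_cpNorm d i n N Set.univ
  · rw [← Set.inter_union_distrib_left]
    exact finite_boundedCP_cpNorm d i (n + 1) N _

theorem arrayGF_top {d i n : ℕ} (hi : i + 1 ≤ d) :
    arrayGF (boundedCP d i n ∩ {π | π (0, i + 1) = n}) =
      PowerSeries.X ^ n * arrayGF (boundedCP d (i + 1) n) := by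
  rw [← image_addTop hi, arrayGF_image (addTop_injective i n) (cpNorm_addTop i n)]

theorem arrayGF_bottom {d i n : ℕ} (hi : i + 1 ≤ d) :
    arrayGF (boundedCP d (i + 1) n ∩ {π | π (1, 1) = n}) =
      PowerSeries.X ^ n * arrayGF (boundedCP d i n) := by
  rw [← image_addBottom hi, arrayGF_image (addBottom_injective n) (cpNorm_addBottom n)]

theorem arrayGF_top_inter_bottom {d i n : ℕ} (hi : i + 1 ≤ d) :
    arrayGF (boundedCP d i n ∩ {π | π (0, i + 1) = n} ∩
      (boundedCP d i n ∩ {π | π (1, 1) = n})) =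
      PowerSeries.X ^ (2 * n) * arrayGF (boundedCP d i n) := by
  have e : boundedCP d i n ∩ {π | π (0, i + 1) = n} ∩ (boundedCP d i n ∩ {π | π (1, 1) = n}) =
      addTop i n '' (boundedCP d (i + 1) n ∩ {π | π (1, 1) = n}) := by
    have hp : {π : Fin 2 × ℕ →₀ ℕ | π (1, 1) = n} =
        addTop i n ⁻¹' {π : Fin 2 × ℕ →₀ ℕ | π (1, 1) = n} := by
      ext π
      simp [addTop_apply_one]
    rw [hp, Set.image_inter_preimage, image_addTop hi, ← hp]
    ext π
    simp only [Set.mem_inter_iff]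
    tauto
  rw [e, arrayGF_image (addTop_injective i n) (cpNorm_addTop i n), arrayGF_bottom hi]
  ring

/-- Inclusion–exclusion over the rows whose first entry is the bound `n + 1`: removing the first
entry of the first row leads from the profile `i` to `i + 1`, that of the second row to `i - 1`,
and both removals back to `i`. -/
theorem isBoundedGF_arrayGF {d : ℕ} (hd : 1 ≤ d) :
    IsBoundedGF d fun i n => arrayGF (boundedCP d i n) where
  init i hi := by rw [boundedCP_zero hi, arrayGF_singleton_zero]
  rec_succ i hi n := by
    have hs := arrayGF_boundedCP_succ (n := n) hi
    rcases Nat.eq_zero_or_pos i with rfl | hi0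
    · -- for `i = 0` the first entry of the first row dominates
      have hsub : boundedCP d 0 (n + 1) ∩ {π | π (1, 1) = n + 1} ⊆
          boundedCP d 0 (n + 1) ∩ {π | π (0, 0 + 1) = n + 1} := by
        rintro π ⟨h, h1 : π (1, 1) = n + 1⟩
        refine ⟨h, le_antisymm (h.2 _) ?_⟩
        rw [← h1]
        exact ((mem_cylindricPartitions_iff hi).1 h.1).2.2.1 1 one_pos
      rw [Set.union_eq_left.2 hsub, arrayGF_top hd] at hs
      rw [extendFamily_of_le hd, extendFamily]
      linear_combination hs
    obtain ⟨i, rfl⟩ := Nat.exists_eq_succ_of_ne_zero hi0.ne'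
    rw [Nat.succ_eq_add_one] at *
    rw [extendFamily_of_le (by omega)]
    rcases (show i + 2 ≤ d ∨ d = i + 1 by omega) with hid | rfl
    · have hu := arrayGF_union_add_inter
        (finite_boundedCP_cpNorm d (i + 1) (n + 1) · {π | π (0, i + 1 + 1) = n + 1})
        (finite_boundedCP_cpNorm d (i + 1) (n + 1) · {π | π (1, 1) = n + 1})
      rw [arrayGF_top hid, arrayGF_bottom hi, arrayGF_top_inter_bottom hid] at hu
      rw [extendFamily_of_le (j := i + 2) hid]
      linear_combination hs + hu
    · -- for `i = d` the first entry of the second row dominates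
      have hsub : boundedCP (i + 1) (i + 1) (n + 1) ∩ {π | π (0, i + 1 + 1) = n + 1} ⊆
          boundedCP (i + 1) (i + 1) (n + 1) ∩ {π | π (1, 1) = n + 1} := by
        rintro π ⟨h, h1 : π (0, i + 1 + 1) = n + 1⟩
        refine ⟨h, le_antisymm (h.2 _) ?_⟩
        rw [← h1, Nat.add_comm (i + 1) 1]
        exact ((mem_cylindricPartitions_iff hi).1 h.1).2.2.2 1 one_pos
      rw [Set.union_eq_right.2 hsub, arrayGF_bottom hi] at hs
      rw [extendFamily_last]
      linear_combination hs

/-! ### Summing over partitions with a given largest part -/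

/-- The sequence `m, l 0, l 1, …`. -/
def consPart (m : ℕ) (l : ℕ → ℕ) : ℕ → ℕ
  | 0 => m
  | j + 1 => l j

theorem consPart_injective (m : ℕ) : Function.Injective (consPart m) := fun _ _ h =>
  funext fun j => congrFun h (j + 1)

open scoped Classical in
/-- The partitions with at most `k + 1` non-zero parts and largest part `m`. -/
def topParts : ℕ → ℕ → Finset (ℕ → ℕ)
  | 0, m => {consPart m 0}
  | k + 1, m => (Finset.range (m + 1)).biUnion fun m' => (topParts k m').image (consPart m)

theorem mem_topParts {k m : ℕ} {l : ℕ → ℕ} :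
    l ∈ topParts k m ↔ l ∈ partitionsAtMost (k + 1) ∧ l 0 = m := by
  classical
  induction k generalizing m l with
  | zero =>
    rw [topParts, Finset.mem_singleton]
    constructor
    · rintro rfl
      refine ⟨⟨antitone_nat_of_succ_le fun j => Nat.zero_le _, fun j hj => ?_⟩, rfl⟩
      obtain ⟨j, rfl⟩ := Nat.exists_eq_add_of_le' hj
      rfl
    · rintro ⟨⟨-, h⟩, rfl⟩
      funext j
      cases j with
      | zero => rfl
      | succ j => exact h (j + 1) (by omega)
  | succ k ih =>
    simp only [topParts, Finset.mem_biUnion, Finset.mem_image, Finset.mem_range]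
    constructor
    · rintro ⟨m', hm', l, hl, rfl⟩
      obtain ⟨⟨ha, hz⟩, rfl⟩ := ih.1 hl
      refine ⟨⟨antitone_nat_of_succ_le fun j => ?_, fun j hj => ?_⟩, rfl⟩
      · cases j with
        | zero => exact Nat.lt_succ_iff.1 hm'
        | succ j => exact ha (Nat.le_succ j)
      · obtain ⟨j, rfl⟩ := Nat.exists_eq_succ_of_ne_zero (by omega : j ≠ 0)
        exact hz j (by omega)
    · rintro ⟨⟨ha, hz⟩, rfl⟩
      refine ⟨l 1, Nat.lt_succ_iff.2 (ha zero_le_one), fun j => l (j + 1), ih.2 ⟨⟨?_, ?_⟩, rfl⟩, ?_⟩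
      · exact fun a b hab => ha (Nat.succ_le_succ hab)
      · exact fun j hj => hz (j + 1) (by omega)
      · funext j
        cases j <;> rfl

theorem sum_topParts_succ (k m : ℕ) (F : (ℕ → ℕ) → ℤ⟦X⟧) :
    ∑ l ∈ topParts (k + 1) m, F l =
      ∑ m' ∈ Finset.range (m + 1), ∑ l ∈ topParts k m', F (consPart m l) := by
  classical
  rw [topParts, Finset.sum_biUnion]
  · exact Finset.sum_congr rfl fun m' _ =>
      Finset.sum_image fun l _ l' _ h => consPart_injective m h
  · intro a _ b _ hab
    rw [Function.onFun, Finset.disjoint_left]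
    intro l ha hb
    obtain ⟨l1, h1, rfl⟩ := Finset.mem_image.1 ha
    obtain ⟨l2, h2, h⟩ := Finset.mem_image.1 hb
    rw [consPart_injective m h] at h2
    exact hab ((mem_topParts.1 h1).2.symm.trans (mem_topParts.1 h2).2)

theorem recip_prod {ι : Type*} (s : Finset ι) (φ : ι → ℤ⟦X⟧)
    (h : ∀ i ∈ s, PowerSeries.constantCoeff (φ i) = 1) :
    recip (∏ i ∈ s, φ i) = ∏ i ∈ s, recip (φ i) := by
  refine (recip_unique ?_ ?_).symm
  · rw [map_prod]
    exact Finset.prod_eq_one h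
  · rw [← Finset.prod_mul_distrib]
    exact Finset.prod_eq_one fun i hi => mul_recip (h i hi)

theorem recip_fermionicDenominator {f : ℕ} (hf : f ≠ 0) (k : ℕ) (l : ℕ → ℕ) :
    recip (fermionicDenominator k f l) =
      (∏ j ∈ Finset.range (k - 1), recipPoch 1 (l j - l (j + 1))) * recipPoch f (l (k - 1)) := by
  have h1 : ∀ n, PowerSeries.constantCoeff
      (qPoch (PowerSeries.X : ℤ⟦X⟧) PowerSeries.X n) = 1 := fun n => by
    simpa using constantCoeff_qPoch 1 one_ne_zero n
  rw [fermionicDenominator, recip_mul _ (constantCoeff_qPoch f hf _), recip_prod _ _ fun _ _ => h1 _]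
  · simp only [recipPoch_one]
    rfl
  · rw [map_prod]
    exact Finset.prod_eq_one fun _ _ => h1 _

theorem recip_fermionicDenominator_consPart {f : ℕ} (hf : f ≠ 0) (k m : ℕ) (l : ℕ → ℕ) :
    recip (fermionicDenominator (k + 2) f (consPart m l)) =
      recip (fermionicDenominator (k + 1) f l) * recipPoch 1 (m - l 0) := by
  rw [recip_fermionicDenominator hf, recip_fermionicDenominator hf,
    show k + 2 - 1 = k + 1 from rfl, show k + 1 - 1 = k from rfl, Finset.prod_range_succ']
  simp only [consPart]
  ring

theorem fermionicTerm_consPart_zero {f : ℕ} (hf : f ≠ 0) (k m : ℕ) (l : ℕ → ℕ) :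
    fermionicTerm (k + 2) 0 f (consPart m l) =
      PowerSeries.X ^ (m ^ 2) * PowerSeries.X ^ m *
        (fermionicTerm (k + 1) 0 f l * recipPoch 1 (m - l 0)) := by
  have e : fermionicExponent (k + 2) 0 (consPart m l) =
      m ^ 2 + m + fermionicExponent (k + 1) 0 l := by
    simp only [fermionicExponent, Nat.Ico_zero_eq_range]
    rw [Finset.sum_range_succ', Finset.sum_range_succ' (fun j => consPart m l j)]
    simp only [consPart]
    ring
  rw [fermionicTerm, fermionicTerm, e, recip_fermionicDenominator_consPart hf, pow_add, pow_add]
  ring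

theorem fermionicTerm_consPart_succ {f : ℕ} (hf : f ≠ 0) (k i m : ℕ) (l : ℕ → ℕ) :
    fermionicTerm (k + 2) (i + 1) f (consPart m l) =
      PowerSeries.X ^ (m ^ 2) * (fermionicTerm (k + 1) i f l * recipPoch 1 (m - l 0)) := by
  have e : fermionicExponent (k + 2) (i + 1) (consPart m l) =
      m ^ 2 + fermionicExponent (k + 1) i l := by
    simp only [fermionicExponent]
    rw [Finset.sum_range_succ', ← Finset.sum_Ico_add' (fun j => consPart m l j) i (k + 1) 1]
    simp only [consPart]
    ring
  rw [fermionicTerm, fermionicTerm, e, recip_fermionicDenominator_consPart hf, pow_add]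
  ring

/-- The summands with largest part `m` add up to the summand of index `m` in the last of the
`k + 1` transforms. -/
theorem sum_topParts_fermionicTerm {f : ℕ} (hf : f = 1 ∨ f = 2) (k : ℕ) :
    ∀ i ≤ k + 1, ∀ m, ∑ l ∈ topParts k m, fermionicTerm (k + 1) i f l =
      PowerSeries.X ^ (m ^ 2) * extendFamily (2 - f + 2 * k) (burgeIter f k) i m := by
  have hf0 : f ≠ 0 := by omega
  induction k with
  | zero =>
    intro i hi m
    rw [topParts, Finset.sum_singleton, fermionicTerm, recip_fermionicDenominator hf0]
    rcases (show i = 0 ∨ i = 1 by omega) with rfl | rfl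
    · simp [fermionicExponent, consPart, extendFamily, burgeIter, pow_add, mul_assoc]
    · simp [fermionicExponent, consPart, extendFamily, burgeIter]
  | succ k ih =>
    have hconv : ∀ i ≤ k + 1, ∀ m, ∑ m' ∈ Finset.range (m + 1), ∑ l ∈ topParts k m',
        fermionicTerm (k + 1) i f l * recipPoch 1 (m - l 0) = burgeIter f (k + 1) i m := by
      intro i hi m
      rw [burgeIter, burge, convPoch]
      refine Finset.sum_congr rfl fun m' _ => ?_
      rw [← ih i hi m', Finset.sum_mul]
      exact Finset.sum_congr rfl fun l hl => by rw [(mem_topParts.1 hl).2]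
    intro i hi m
    rw [sum_topParts_succ]
    cases i with
    | zero =>
      simp only [fermionicTerm_consPart_zero hf0, ← Finset.mul_sum]
      rw [hconv 0 (Nat.zero_le _), extendFamily, mul_assoc]
    | succ i =>
      simp only [fermionicTerm_consPart_succ hf0, ← Finset.mul_sum]
      rw [hconv i (by omega), extendFamily_of_le (by omega)]

/-! ### Non-negativity -/

theorem NonnegCoeffs.mul {φ ψ : ℤ⟦X⟧} (hφ : NonnegCoeffs φ) (hψ : NonnegCoeffs ψ) :
    NonnegCoeffs (φ * ψ) := fun n => by
  rw [PowerSeries.coeff_mul]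
  exact Finset.sum_nonneg fun p _ => mul_nonneg (hφ _) (hψ _)

theorem nonnegCoeffs_X_pow (m : ℕ) : NonnegCoeffs (PowerSeries.X ^ m) := fun n => by
  rw [PowerSeries.coeff_X_pow]
  split_ifs <;> decide

theorem nonnegCoeffs_prod {ι : Type*} (s : Finset ι) (φ : ι → ℤ⟦X⟧)
    (h : ∀ i ∈ s, NonnegCoeffs (φ i)) : NonnegCoeffs (∏ i ∈ s, φ i) :=
  Finset.prod_induction _ NonnegCoeffs (fun _ _ => NonnegCoeffs.mul)
    (by simpa using nonnegCoeffs_X_pow 0) h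

/-- Division by `1 - q ^ m` preserves non-negativity: `φ = ψ + q ^ m φ` determines the
coefficients of `φ` successively. -/
theorem NonnegCoeffs.of_one_sub_X_pow_mul {φ : ℤ⟦X⟧} {m : ℕ} (hm : m ≠ 0)
    (h : NonnegCoeffs ((1 - PowerSeries.X ^ m) * φ)) : NonnegCoeffs φ := by
  intro n
  induction n using Nat.strong_induction_on with
  | _ n ih =>
    have hn := h n
    rw [sub_mul, one_mul, map_sub, PowerSeries.coeff_X_pow_mul'] at hn
    split_ifs at hn with hmn
    · have := ih (n - m) (by omega)
      omega
    · omega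

theorem nonnegCoeffs_recipPoch {f : ℕ} (hf : f ≠ 0) (n : ℕ) : NonnegCoeffs (recipPoch f n) := by
  induction n with
  | zero =>
    rw [recipPoch_zero]
    simpa using nonnegCoeffs_X_pow 0
  | succ n ih =>
    rw [← recipPoch_succ hf n] at ih
    exact ih.of_one_sub_X_pow_mul (mul_ne_zero hf n.succ_ne_zero)

theorem nonnegCoeffs_fermionicTerm {f : ℕ} (hf : f ≠ 0) (k i : ℕ) (l : ℕ → ℕ) :
    NonnegCoeffs (fermionicTerm k i f l) := by
  rw [fermionicTerm, recip_fermionicDenominator hf]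
  exact (nonnegCoeffs_X_pow _).mul ((nonnegCoeffs_prod _ _ fun _ _ =>
    nonnegCoeffs_recipPoch one_ne_zero _).mul (nonnegCoeffs_recipPoch hf _))

/-! ### Passage to the limit -/

theorem X_pow_dvd_qPochInf_sub (M : ℕ) :
    (PowerSeries.X : ℤ⟦X⟧) ^ (M + 1) ∣
      qPochInf PowerSeries.X PowerSeries.X - qPoch PowerSeries.X PowerSeries.X M := by
  rw [PowerSeries.X_pow_dvd_iff]
  intro N hN
  have hstep : ∀ c, PowerSeries.coeff N (qPoch (PowerSeries.X : ℤ⟦X⟧) PowerSeries.X (M + c)) =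
      PowerSeries.coeff N (qPoch PowerSeries.X PowerSeries.X M) := by
    intro c
    induction c with
    | zero => rfl
    | succ c ih =>
      rw [← add_assoc, qPoch_succ, ← pow_succ', mul_sub, mul_one, map_sub, ih,
        mul_comm _ (PowerSeries.X ^ _), PowerSeries.coeff_X_pow_mul', if_neg (by omega), sub_zero]
  have ht := ((PowerSeries.WithPiTopology.continuous_coeff ℤ N).tendsto _).comp
    multipliable_qPochInf.hasProd.tendsto_prod_nat
  have hconst : Filter.Tendsto ((PowerSeries.coeff (R := ℤ) N) ∘ fun n =>
      ∏ i ∈ Finset.range n, (1 - PowerSeries.X * PowerSeries.X ^ i : ℤ⟦X⟧)) Filter.atTop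
      (nhds (PowerSeries.coeff N (qPoch (PowerSeries.X : ℤ⟦X⟧) PowerSeries.X M))) := by
    refine tendsto_const_nhds.congr' ?_
    filter_upwards [Filter.eventually_ge_atTop M] with n hn
    obtain ⟨c, rfl⟩ := Nat.exists_eq_add_of_le hn
    exact (hstep c).symm
  rw [map_sub, sub_eq_zero]
  exact tendsto_nhds_unique ht hconst

theorem X_pow_dvd_recipPoch_sub (M : ℕ) :
    PowerSeries.X ^ (M + 1) ∣
      recipPoch 1 M - recip (qPochInf PowerSeries.X PowerSeries.X) := by
  obtain ⟨a, ha⟩ := X_pow_dvd_qPochInf_sub M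
  have h1 := mul_recip constantCoeff_qPochInf
  have h2 := mul_recip (φ := qPoch (PowerSeries.X : ℤ⟦X⟧) PowerSeries.X M)
    (by simpa using constantCoeff_qPoch 1 one_ne_zero M)
  rw [recipPoch_one]
  set u := recip (qPochInf PowerSeries.X PowerSeries.X)
  set v := recip (qPoch PowerSeries.X PowerSeries.X M)
  exact ⟨a * u * v, by linear_combination u * v * ha - v * h1 + u * h2⟩

theorem nonnegCoeffs_recip_qPochInf :
    NonnegCoeffs (recip (qPochInf PowerSeries.X PowerSeries.X)) := fun n => by
  have h := PowerSeries.X_pow_dvd_iff.1 (X_pow_dvd_recipPoch_sub n) n (Nat.lt_succ_self n)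
  rw [map_sub, sub_eq_zero] at h
  rw [← h]
  exact nonnegCoeffs_recipPoch one_ne_zero n n

/-- Coefficientwise sum of a sequence `h` with `h m` divisible by `q ^ m`. -/
def coeffSum (h : ℕ → ℤ⟦X⟧) : ℤ⟦X⟧ :=
  PowerSeries.mk fun N => PowerSeries.coeff N (∑ m ∈ Finset.range (N + 1), h m)

theorem X_pow_dvd_coeffSum_sub {h : ℕ → ℤ⟦X⟧} (hh : ∀ m, PowerSeries.X ^ m ∣ h m) (N : ℕ) :
    PowerSeries.X ^ (N + 1) ∣ coeffSum h - ∑ m ∈ Finset.range (N + 1), h m := by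
  rw [PowerSeries.X_pow_dvd_iff]
  intro n hn
  rw [map_sub, sub_eq_zero, coeffSum, PowerSeries.coeff_mk, map_sum, map_sum]
  refine Finset.sum_subset (Finset.range_mono (by omega)) fun m _ hm => ?_
  exact PowerSeries.X_pow_dvd_iff.1 (hh m) n (by simpa using hm)

/-- As `n` tends to infinity, convolution with `1 / (q; q)_n` becomes multiplication by
`1 / (q; q)_∞`. -/
theorem X_pow_dvd_convPoch_sub {h : ℕ → ℤ⟦X⟧} (hh : ∀ m, PowerSeries.X ^ m ∣ h m) (N : ℕ) :
    PowerSeries.X ^ (N + 1) ∣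
      convPoch h (2 * N) - recip (qPochInf PowerSeries.X PowerSeries.X) * coeffSum h := by
  set u := recip (qPochInf PowerSeries.X PowerSeries.X)
  have hsplit : convPoch h (2 * N) - u * coeffSum h =
      ∑ m ∈ Finset.range (N + 1), h m * (recipPoch 1 (2 * N - m) - u) +
      ∑ m ∈ Finset.Ico (N + 1) (2 * N + 1), h m * recipPoch 1 (2 * N - m) -
      u * (coeffSum h - ∑ m ∈ Finset.range (N + 1), h m) := by
    rw [convPoch, ← Finset.sum_range_add_sum_Ico _ (show N + 1 ≤ 2 * N + 1 by omega)]
    simp only [mul_sub, Finset.sum_sub_distrib, ← Finset.sum_mul]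
    ring
  rw [hsplit]
  refine dvd_sub (dvd_add (Finset.dvd_sum fun m hm => ?_) (Finset.dvd_sum fun m hm => ?_))
    ((X_pow_dvd_coeffSum_sub hh N).mul_left u)
  · rw [Finset.mem_range] at hm
    exact ((pow_dvd_pow _ (by omega)).trans (X_pow_dvd_recipPoch_sub (2 * N - m))).mul_left _
  · rw [Finset.mem_Ico] at hm
    exact ((pow_dvd_pow _ hm.1).trans (hh m)).mul_right _

theorem hasSum_cylindricPartitions {r : ℕ} (m : Fin r → ℕ) :
    HasSum (fun π : cylindricPartitions m => (PowerSeries.X ^ cpNorm π.1 : ℤ⟦X⟧))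
      (arrayGF (cylindricPartitions m)) := by
  classical
  rw [PowerSeries.WithPiTopology.hasSum_iff_hasSum_coeff]
  intro N
  have hfin := finite_cylindricPartitions_cpNorm m N
  have hmem : ∀ π ∈ hfin.toFinset, π ∈ cylindricPartitions m := fun π hπ =>
    (hfin.mem_toFinset.1 hπ).1
  have hsum : PowerSeries.coeff N (arrayGF (cylindricPartitions m)) =
      ∑ π ∈ hfin.toFinset.subtype (· ∈ cylindricPartitions m),
        PowerSeries.coeff N (PowerSeries.X ^ cpNorm π.1 : ℤ⟦X⟧) := by
    rw [Finset.sum_subtype_of_mem (fun π => PowerSeries.coeff N (PowerSeries.X ^ cpNorm π : ℤ⟦X⟧))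
      hmem, arrayGF, PowerSeries.coeff_mk, Set.ncard_eq_toFinset_card _ hfin,
      Finset.card_eq_sum_ones, Nat.cast_sum]
    refine Finset.sum_congr rfl fun π hπ => ?_
    rw [PowerSeries.coeff_X_pow, if_pos (hfin.mem_toFinset.1 hπ).2.symm, Nat.cast_one]
  rw [hsum]
  refine hasSum_sum_of_ne_finset_zero fun π hπ => ?_
  rw [PowerSeries.coeff_X_pow, if_neg]
  rintro rfl
  exact hπ (Finset.mem_subtype.2 (hfin.mem_toFinset.2 ⟨π.2, rfl⟩))

theorem coeff_arrayGF_cylindricPartitions {d i n N : ℕ} (hN : N ≤ n) :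
    PowerSeries.coeff N (arrayGF (cylindricPartitions ![d - i, i])) =
      PowerSeries.coeff N (arrayGF (boundedCP d i n)) := by
  have e : cylindricPartitions ![d - i, i] ∩ {π | cpNorm π = N} =
      boundedCP d i n ∩ {π | cpNorm π = N} := by
    ext π
    constructor
    · rintro ⟨h, rfl⟩
      exact ⟨⟨h, fun p => (le_cpNorm π p).trans hN⟩, rfl⟩
    · rintro ⟨h, rfl⟩
      exact ⟨h.1, rfl⟩
  rw [arrayGF, arrayGF, PowerSeries.coeff_mk, PowerSeries.coeff_mk, e]

theorem hasSum_fermionicTerm (k i f : ℕ) :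
    HasSum (fun l : partitionsAtMost (k + 1) => fermionicTerm (k + 1) i f l.1)
      (coeffSum fun m => ∑ l ∈ topParts k m, fermionicTerm (k + 1) i f l) := by
  classical
  rw [PowerSeries.WithPiTopology.hasSum_iff_hasSum_coeff]
  intro N
  have hmem : ∀ l ∈ (Finset.range (N + 1)).biUnion (topParts k), l ∈ partitionsAtMost (k + 1) := by
    intro l hl
    obtain ⟨m, -, hl⟩ := Finset.mem_biUnion.1 hl
    exact (mem_topParts.1 hl).1
  have hdisj : Set.PairwiseDisjoint (↑(Finset.range (N + 1))) (topParts k) := by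
    intro a _ b _ hab
    rw [Function.onFun, Finset.disjoint_left]
    exact fun l ha hb => hab ((mem_topParts.1 ha).2.symm.trans (mem_topParts.1 hb).2)
  rw [coeffSum, PowerSeries.coeff_mk, ← Finset.sum_biUnion hdisj, map_sum,
    ← Finset.sum_subtype_of_mem _ hmem]
  refine hasSum_sum_of_ne_finset_zero fun l hl => ?_
  rw [fermionicTerm, PowerSeries.coeff_X_pow_mul', if_neg]
  intro hle
  refine hl (Finset.mem_subtype.2 (Finset.mem_biUnion.2
    ⟨l.1 0, Finset.mem_range.2 ?_, mem_topParts.2 ⟨l.2, rfl⟩⟩))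
  have h0 : l.1 0 ^ 2 ≤ ∑ j ∈ Finset.range (k + 1), l.1 j ^ 2 :=
    Finset.single_le_sum (f := fun j => l.1 j ^ 2) (fun _ _ => Nat.zero_le _)
      (Finset.mem_range.2 k.succ_pos)
  have h1 : l.1 0 ≤ l.1 0 ^ 2 := Nat.le_self_pow two_ne_zero _
  rw [fermionicExponent] at hle
  omega

/-- The summation formula at the level `d = 2 - f + 2 * (k + 1)`, which for `f = 1` runs through
the odd and for `f = 2` through the even integers. -/
theorem cylindricGF_eq {f : ℕ} (hf : f = 1 ∨ f = 2) {k i : ℕ} (hi : i ≤ k + 1) :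
    cylindricGF ![2 - f + 2 * (k + 1) - i, i] =
      recip (qPochInf PowerSeries.X PowerSeries.X) *
        ∑' l : partitionsAtMost (k + 1), fermionicTerm (k + 1) i f l.1 := by
  rw [cylindricGF, (hasSum_cylindricPartitions _).tsum_eq, (hasSum_fermionicTerm k i f).tsum_eq]
  have hsum := funext (sum_topParts_fermionicTerm hf k i hi)
  rw [hsum]
  ext N
  have hdvd : ∀ m, PowerSeries.X ^ m ∣
      PowerSeries.X ^ (m ^ 2) * extendFamily (2 - f + 2 * k) (burgeIter f k) i m := fun m =>
    (pow_dvd_pow _ (Nat.le_self_pow two_ne_zero m)).mul_right _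
  have hlim := PowerSeries.X_pow_dvd_iff.1 (X_pow_dvd_convPoch_sub hdvd N) N (Nat.lt_succ_self N)
  rw [map_sub, sub_eq_zero] at hlim
  rw [coeff_arrayGF_cylindricPartitions (show N ≤ 2 * N by omega), ← hlim,
    (isBoundedGF_arrayGF (by omega)).unique (isBoundedGF_burgeIter hf (k + 1)) (2 * N) i (by omega)]
  rfl

theorem mainTheorem2 (d k i : ℕ) (hd : 2 ≤ d) (hk : k = d / 2) (hi : i ≤ k) :
    (Summable fun π : cylindricPartitions ![d - i, i] =>
        (PowerSeries.X ^ cpNorm π.1 : ℤ⟦X⟧)) ∧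
    NonnegCoeffs (recip (qPochInf PowerSeries.X PowerSeries.X)) ∧
    (Odd d →
      (∀ l : partitionsAtMost k, NonnegCoeffs (fermionicTerm k i 1 l.1)) ∧
      (Summable fun l : partitionsAtMost k => fermionicTerm k i 1 l.1) ∧
      cylindricGF ![d - i, i] =
        recip (qPochInf PowerSeries.X PowerSeries.X) *
          ∑' l : partitionsAtMost k, fermionicTerm k i 1 l.1) ∧
    (Even d →
      (∀ l : partitionsAtMost k, NonnegCoeffs (fermionicTerm k i 2 l.1)) ∧
      (Summable fun l : partitionsAtMost k => fermionicTerm k i 2 l.1) ∧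
      cylindricGF ![d - i, i] =
        recip (qPochInf PowerSeries.X PowerSeries.X) *
          ∑' l : partitionsAtMost k, fermionicTerm k i 2 l.1) := by
  obtain ⟨k, rfl⟩ := Nat.exists_eq_succ_of_ne_zero (show k ≠ 0 by omega)
  refine ⟨(hasSum_cylindricPartitions _).summable, nonnegCoeffs_recip_qPochInf,
    fun hodd => ⟨fun l => nonnegCoeffs_fermionicTerm one_ne_zero _ _ _,
      (hasSum_fermionicTerm k i 1).summable, ?_⟩,
    fun heven => ⟨fun l => nonnegCoeffs_fermionicTerm two_ne_zero _ _ _,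
      (hasSum_fermionicTerm k i 2).summable, ?_⟩⟩
  · obtain rfl : d = 2 - 1 + 2 * (k + 1) := by
      have := Nat.odd_iff.1 hodd
      omega
    exact cylindricGF_eq (Or.inl rfl) hi
  · obtain rfl : d = 2 - 2 + 2 * (k + 1) := by
      have := Nat.even_iff.1 heven
      omega
    exact cylindricGF_eq (Or.inr rfl) hi

end
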